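/- Let $N\ge 1$ be an integer and let $\phi:\mathbb{R}^{N+1}\setminus\{0\}\to\mathbb{P}^N(\mathbb{R})$ be the quotient map. Equip $\mathbb{P}^N(\mathbb{R})$ with the metric $$\delta_\infty(\hat{\mathbf x},\hat{\mathbf y})=\frac{|\mathbf x\wedge\mathbf y|}{|\mathbf x|\,|\mathbf y|},\qquad \hat{\mathbf x}=\phi(\mathbf x),\ \hat{\mathbf y}=\phi(\mathbf y),$$ where $|\cdot|$ denotes the Euclidean norms on $\mathbb{R}^{N+1}$ and on $\bigwedge^2\mathbb{R}^{N+1}$ (so $\delta_\infty$ is the sine of the angle between two lines), and let $\hat B(\hat{\mathbf x},r)$ be the closed ball of centre $\hat{\mathbf x}$ and radius $r$. For $\hat{\mathbf q}\in\mathbb{P}^N(\mathbb{Q})$ let $H(\hat{\mathbf q})=\max_i|q_i|$, where $(q_1,\dots,q_{N+1})$ are coprime integer homogeneous coordinates of $\hat{\mathbf q}$, and let $$\mathbf{Bad}_{\mathbb P}^\infty=\Big\{\hat{\mathbf x}\in\mathbb{P}^N(\mathbb{R}):\ \inf_{\hat{\mathbf q}\in\mathbb{P}^N(\mathbb{Q})}H(\hat{\mathbf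 q})^{\frac{N+1}{N}}\,\delta_\infty(\hat{\mathbf x},\hat{\mathbf q})>0\Big\}.$$ Let $\Omega$ be a non-empty compact subset of $\mathbb{P}^N(\mathbb{R})$, let $\delta,\eta>0$, and let $m$ be a locally finite Borel measure on $\mathbb{P}^N(\mathbb{R})$ supported on $\Omega$, i.e. $m(\mathbb{P}^N(\mathbb{R})\setminus\Omega)=0$, such that: 1. ($\delta$-Ahlfors regularity) there are constants $0<a\le 1\le b$ and $r_0>0$ such that $a r^\delta\le m(\hat B(\hat{\mathbf x},r))\le b r^\delta$ for all $\hat{\mathbf x}\in\Omega$ and $0<r<r_0$; 2. (projective absolute $\eta$-decay) there are constants $c>0$ and $r_0>0$ such that $$m\big(\hat B(\hat{\mathbf x},r)\cap\mathcal P^{(\epsilon)}\big)\le c\left(\frac{\epsilon}{r}\right)^{\eta}m(\hat B(\hat{\mathbf x},r))$$ for every projective hyperplane $\mathcal P$ (the image under $\phi$ of the non-zero vectors of an $N$-dimensional linear subspace of $\mathbb{R}^{N+1}$), every $\epsilon>0$, every $\hat{\mathbf x}\in\Omega$ and every $0<r<r_0$, where $\mathcal P^{(\epsilon)}=\{\hat{\mathbf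 x}\in\mathbb{P}^N(\mathbb{R}):\inf_{\hat{\mathbf y}\in\mathcal P}\delta_\infty(\hat{\mathbf x},\hat{\mathbf y})<\epsilon\}$. Then $$\dim_{\mathrm H}(\mathbf{Bad}_{\mathbb P}^\infty\cap\Omega)=\dim_{\mathrm H}(\Omega)=\delta,$$ where $\dim_{\mathrm H}$ denotes Hausdorff dimension with respect to $\delta_\infty$. -/

import Mathlib

open scoped LinearAlgebra.Projectivization ENNReal

namespace ProjBad

/-- Real projective space of dimension `N`: the lines of the Euclidean space `ℝ^(N+1)`. -/
abbrev RealProj (N : ℕ) : Type := ℙ ℝ (EuclideanSpace ℝ (Fin (N + 1)))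

/-- Rational projective space of dimension `N`. -/
abbrev RatProj (N : ℕ) : Type := ℙ ℚ (Fin (N + 1) → ℚ)

/-- The Euclidean norm of `x ∧ y`, whose coordinates in the standard basis of the second exterior
power are the minors `x i * y j - x j * y i` with `i < j`. -/
noncomputable def wedgeNorm {N : ℕ} (x y : EuclideanSpace ℝ (Fin (N + 1))) : ℝ :=
  Real.sqrt (∑ i, ∑ j ∈ Finset.Ioi i, (x i * y j - x j * y i) ^ 2)

/-- The distance `|x ∧ y| / (|x| |y|)` between the lines through `x` and `y`, that is, the sine of
the angle between them. It does not depend on the representatives, see `projDist_mk`. -/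
noncomputable def projDist {N : ℕ} (x y : RealProj N) : ℝ :=
  wedgeNorm x.rep y.rep / (‖x.rep‖ * ‖y.rep‖)

lemma wedgeNorm_smul {N : ℕ} (s t : ℝ) (x y : EuclideanSpace ℝ (Fin (N + 1))) :
    wedgeNorm (s • x) (t • y) = |s| * |t| * wedgeNorm x y := by
  unfold wedgeNorm
  have h : ∀ i j, ((s • x) i * (t • y) j - (s • x) j * (t • y) i) ^ 2
      = (s * t) ^ 2 * (x i * y j - x j * y i) ^ 2 := by
    intro i j
    simp only [PiLp.smul_apply, smul_eq_mul]
    ring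
  simp only [h, ← Finset.mul_sum]
  rw [Real.sqrt_mul (sq_nonneg _), Real.sqrt_sq_eq_abs, abs_mul]

lemma projDist_mk {N : ℕ} (x y : EuclideanSpace ℝ (Fin (N + 1))) (hx : x ≠ 0) (hy : y ≠ 0) :
    projDist (Projectivization.mk ℝ x hx) (Projectivization.mk ℝ y hy)
      = wedgeNorm x y / (‖x‖ * ‖y‖) := by
  obtain ⟨a, ha⟩ := Projectivization.exists_smul_eq_mk_rep ℝ x hx
  obtain ⟨b, hb⟩ := Projectivization.exists_smul_eq_mk_rep ℝ y hy
  have ha0 : |(a : ℝ)| ≠ 0 := abs_ne_zero.2 a.ne_zero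
  have hb0 : |(b : ℝ)| ≠ 0 := abs_ne_zero.2 b.ne_zero
  have hx0 : ‖x‖ ≠ 0 := norm_ne_zero_iff.2 hx
  have hy0 : ‖y‖ ≠ 0 := norm_ne_zero_iff.2 hy
  unfold projDist
  rw [← ha, ← hb, Units.smul_def, Units.smul_def, wedgeNorm_smul, norm_smul, norm_smul,
    Real.norm_eq_abs, Real.norm_eq_abs]
  field_simp

lemma sum_minors {N : ℕ} (x y : EuclideanSpace ℝ (Fin (N + 1))) :
    2 * ∑ i, ∑ j ∈ Finset.Ioi i, (x i * y j - x j * y i) ^ 2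
      = ∑ i, ∑ j, (x i * y j - x j * y i) ^ 2 := by
  have hsplit : ∀ i : Fin (N + 1), ∑ j, (x i * y j - x j * y i) ^ 2
      = ∑ j ∈ Finset.Ioi i, (x i * y j - x j * y i) ^ 2
        + ∑ j ∈ Finset.Iio i, (x i * y j - x j * y i) ^ 2 := by
    intro i
    rw [← Finset.sum_union]
    · symm
      apply Finset.sum_subset (Finset.subset_univ _)
      intro j _ hj
      have : j = i := by
        simp only [Finset.mem_union, Finset.mem_Ioi, Finset.mem_Iio, not_or, not_lt] at hj
        exact le_antisymm hj.1 hj.2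
      subst this
      ring
    · rw [Finset.disjoint_left]
      intro j h1 h2
      exact lt_asymm (Finset.mem_Ioi.1 h1) (Finset.mem_Iio.1 h2)
  have hswap : ∑ i, ∑ j ∈ Finset.Iio i, (x i * y j - x j * y i) ^ 2
      = ∑ i, ∑ j ∈ Finset.Ioi i, (x i * y j - x j * y i) ^ 2 := by
    rw [Finset.sum_comm' (t' := Finset.univ) (s' := fun j => Finset.Ioi j)]
    · refine Finset.sum_congr rfl fun i _ => Finset.sum_congr rfl fun j _ => ?_
      ring
    · intro i j
      simp
  rw [Finset.sum_congr rfl fun i _ => hsplit i, Finset.sum_add_distrib, hswap]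
  ring

/-- The matrix of the orthogonal projection onto the line through `x`, used only to verify the
axioms of a metric. -/
noncomputable def lineProj {N : ℕ} (x : EuclideanSpace ℝ (Fin (N + 1))) :
    EuclideanSpace ℝ (Fin (N + 1) × Fin (N + 1)) :=
  WithLp.toLp 2 fun p => x p.1 * x p.2 / ‖x‖ ^ 2

lemma wedgeNorm_div_eq {N : ℕ} (x y : EuclideanSpace ℝ (Fin (N + 1))) (hx : x ≠ 0) (hy : y ≠ 0) :
    wedgeNorm x y / (‖x‖ * ‖y‖) = dist (lineProj x) (lineProj y) / Real.sqrt 2 := by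
  have hx0 : ‖x‖ ≠ 0 := norm_ne_zero_iff.2 hx
  have hy0 : ‖y‖ ≠ 0 := norm_ne_zero_iff.2 hy
  have hxx : ∑ i, x i ^ 2 = ‖x‖ ^ 2 := (EuclideanSpace.real_norm_sq_eq x).symm
  have hyy : ∑ i, y i ^ 2 = ‖y‖ ^ 2 := (EuclideanSpace.real_norm_sq_eq y).symm
  set c := ∑ i, x i * y i with hc
  have e1 : ∑ i, ∑ j, (x i * y j - x j * y i) ^ 2 = 2 * (‖x‖ ^ 2 * ‖y‖ ^ 2 - c ^ 2) := by
    have : ∀ i j, (x i * y j - x j * y i) ^ 2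
        = x i ^ 2 * y j ^ 2 - 2 * ((x i * y i) * (x j * y j)) + y i ^ 2 * x j ^ 2 := by
      intro i j; ring
    simp only [this, Finset.sum_add_distrib, Finset.sum_sub_distrib, ← Finset.mul_sum,
      ← Finset.sum_mul, hxx, hyy, ← hc]
    ring
  have e2 : ∑ p : Fin (N + 1) × Fin (N + 1),
      (x p.1 * x p.2 / ‖x‖ ^ 2 - y p.1 * y p.2 / ‖y‖ ^ 2) ^ 2
      = 2 * (‖x‖ ^ 2 * ‖y‖ ^ 2 - c ^ 2) / (‖x‖ ^ 2 * ‖y‖ ^ 2) := by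
    have : ∀ i j, (x i * x j / ‖x‖ ^ 2 - y i * y j / ‖y‖ ^ 2) ^ 2
        = x i ^ 2 * (x j ^ 2 * (1 / ‖x‖ ^ 4))
          - (x i * y i) * ((x j * y j) * (2 / (‖x‖ ^ 2 * ‖y‖ ^ 2)))
          + y i ^ 2 * (y j ^ 2 * (1 / ‖y‖ ^ 4)) := by
      intro i j
      field_simp
      ring
    rw [Fintype.sum_prod_type]
    simp only [this, Finset.sum_add_distrib, Finset.sum_sub_distrib, ← Finset.mul_sum,
      ← Finset.sum_mul, hxx, hyy, ← hc]
    field_simp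
    ring
  have hd : dist (lineProj x) (lineProj y)
      = Real.sqrt (2 * (‖x‖ ^ 2 * ‖y‖ ^ 2 - c ^ 2) / (‖x‖ ^ 2 * ‖y‖ ^ 2)) := by
    rw [EuclideanSpace.dist_eq, ← e2]
    simp only [lineProj, Real.dist_eq, sq_abs]
  have hs : ∑ i, ∑ j ∈ Finset.Ioi i, (x i * y j - x j * y i) ^ 2
      = ‖x‖ ^ 2 * ‖y‖ ^ 2 - c ^ 2 := by
    have := sum_minors x y
    linarith
  have hn : ‖x‖ * ‖y‖ = Real.sqrt (‖x‖ ^ 2 * ‖y‖ ^ 2) := by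
    rw [← mul_pow, Real.sqrt_sq (by positivity)]
  rw [hd, wedgeNorm, hs, hn, ← Real.sqrt_div' _ (by positivity), ← Real.sqrt_div' _ (by positivity)]
  congr 1
  field_simp

lemma projDist_eq {N : ℕ} (x y : RealProj N) :
    projDist x y = dist (lineProj x.rep) (lineProj y.rep) / Real.sqrt 2 :=
  wedgeNorm_div_eq _ _ x.rep_nonzero y.rep_nonzero

lemma eq_of_projDist_eq_zero {N : ℕ} {x y : RealProj N} (h : projDist x y = 0) : x = y := by
  have hx0 : ‖x.rep‖ ≠ 0 := norm_ne_zero_iff.2 x.rep_nonzero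
  have hy0 : ‖y.rep‖ ≠ 0 := norm_ne_zero_iff.2 y.rep_nonzero
  have hw : wedgeNorm x.rep y.rep = 0 := by
    rcases div_eq_zero_iff.1 h with h | h
    · exact h
    · exact absurd h (mul_ne_zero hx0 hy0)
  have hsum : ∑ i, ∑ j, (x.rep i * y.rep j - x.rep j * y.rep i) ^ 2 = 0 := by
    rw [← sum_minors, (Real.sqrt_eq_zero (by positivity)).1 hw, mul_zero]
  have hall : ∀ i j, x.rep i * y.rep j = x.rep j * y.rep i := by
    intro i j
    have h1 := (Finset.sum_eq_zero_iff_of_nonneg (fun i _ => by positivity)).1 hsum i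
      (Finset.mem_univ i)
    have h2 := (Finset.sum_eq_zero_iff_of_nonneg (fun j _ => by positivity)).1 h1 j
      (Finset.mem_univ j)
    exact sub_eq_zero.1 (pow_eq_zero_iff two_ne_zero |>.1 h2)
  obtain ⟨j, hj⟩ : ∃ j, y.rep j ≠ 0 := by
    by_contra! hcon
    exact y.rep_nonzero (by ext j; simpa using hcon j)
  rw [← x.mk_rep, ← y.mk_rep, Projectivization.mk_eq_mk_iff']
  refine ⟨x.rep j / y.rep j, ?_⟩
  ext i
  simp only [PiLp.smul_apply, smul_eq_mul]
  rw [div_mul_eq_mul_div, ← hall i j]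
  field_simp

/-- Real projective space with the metric `projDist`. -/
noncomputable instance instMetricSpaceRealProj (N : ℕ) : MetricSpace (RealProj N) where
  dist := projDist
  dist_self x := by rw [projDist_eq]; simp
  dist_comm x y := by rw [projDist_eq, projDist_eq, dist_comm]
  dist_triangle x y z := by
    rw [projDist_eq, projDist_eq, projDist_eq, ← add_div]
    gcongr
    exact dist_triangle _ _ _
  eq_of_dist_eq_zero := eq_of_projDist_eq_zero

noncomputable instance instMeasurableSpaceRealProj (N : ℕ) : MeasurableSpace (RealProj N) := borel _

instance instBorelSpaceRealProj (N : ℕ) : BorelSpace (RealProj N) := ⟨rfl⟩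

/-- The coordinatewise inclusion of `ℚ^(N+1)` into `ℝ^(N+1)`. -/
noncomputable def ratVec (N : ℕ) : (Fin (N + 1) → ℚ) →ₛₗ[algebraMap ℚ ℝ] EuclideanSpace ℝ (Fin (N + 1)) where
  toFun q := WithLp.toLp 2 fun i => (q i : ℝ)
  map_add' p q := by ext i; simp
  map_smul' a q := by ext i; simp

lemma ratVec_injective (N : ℕ) : Function.Injective (ratVec N) := by
  intro p q h
  funext i
  have : ratVec N p i = ratVec N q i := by rw [h]
  simpa [ratVec] using this

/-- The inclusion of rational projective space into real projective space. -/
noncomputable def ratPoint {N : ℕ} (q : RatProj N) : RealProj N :=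
  Projectivization.map (ratVec N) (ratVec_injective N) q

/-- The badly approximable points of real projective space. Here `q.mulHeight` is the usual
height: it equals `max |q i|` over coprime integral homogeneous coordinates of `q`, see
`ratProj_mulHeight`. -/
noncomputable def Bad (N : ℕ) : Set (RealProj N) :=
  {x | 0 < ⨅ q : RatProj N, q.mulHeight ^ (((N : ℝ) + 1) / (N : ℝ)) * dist x (ratPoint q)}

lemma ratProj_mulHeight {N : ℕ} (z : Fin (N + 1) → ℤ) (hz : Finset.univ.gcd z = 1)
    (h0 : (fun i => (z i : ℚ)) ≠ 0) :
    (Projectivization.mk ℚ (fun i => (z i : ℚ)) h0 : RatProj N).mulHeight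
      = ((⨆ i, |z i| : ℤ) : ℝ) := by
  rw [Projectivization.mulHeight_mk]
  exact Rat.mulHeight_eq_max_abs_of_gcd_eq_one hz

/-- The points of projective space lying on the linear subspace `L`. -/
def pointsOn {N : ℕ} (L : Submodule ℝ (EuclideanSpace ℝ (Fin (N + 1)))) : Set (RealProj N) :=
  {x | x.submodule ≤ L}

/-- A projective hyperplane: the points on some `N`-dimensional linear subspace. -/
def IsProjHyperplane {N : ℕ} (P : Set (RealProj N)) : Prop :=
  ∃ L : Submodule ℝ (EuclideanSpace ℝ (Fin (N + 1))), Module.finrank ℝ L = N ∧ P = pointsOn L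

/-- `m` satisfies the power law with exponent `δ` for small closed balls centred in `Ω`. -/
def IsAhlforsRegular {N : ℕ} (Ω : Set (RealProj N)) (δ : ℝ)
    (m : MeasureTheory.Measure (RealProj N)) : Prop :=
  ∃ a b r₀ : ℝ, 0 < a ∧ a ≤ 1 ∧ 1 ≤ b ∧ 0 < r₀ ∧
    ∀ x ∈ Ω, ∀ r : ℝ, 0 < r → r < r₀ →
      ENNReal.ofReal (a * r ^ δ) ≤ m (Metric.closedBall x r) ∧
      m (Metric.closedBall x r) ≤ ENNReal.ofReal (b * r ^ δ)

/-- `m` is projectively `(c, η)`-absolutely decaying on `Ω` for some `c > 0`;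
`Metric.thickening ε P` is the open `ε`-neighbourhood of `P`. -/
def IsProjAbsDecaying {N : ℕ} (Ω : Set (RealProj N)) (η : ℝ)
    (m : MeasureTheory.Measure (RealProj N)) : Prop :=
  ∃ c r₀ : ℝ, 0 < c ∧ 0 < r₀ ∧
    ∀ P : Set (RealProj N), IsProjHyperplane P →
      ∀ ε : ℝ, 0 < ε → ∀ x ∈ Ω, ∀ r : ℝ, 0 < r → r < r₀ →
        m (Metric.closedBall x r ∩ Metric.thickening ε P)
          ≤ ENNReal.ofReal (c * (ε / r) ^ η) * m (Metric.closedBall x r)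

end ProjBad

/-!
Let `τ = (N + 1) / N`. The upper bound `dimH Ω ≤ δ` only uses the lower half of Ahlfors regularity:
disjoint balls of radius `r / 2` centred in `Ω` have mass `≳ r ^ δ` each, so `Ω` is covered by
`≲ r ^ (-δ)` balls of radius `r` (`dimH_le_of_le_measure_closedBall`). The content is the lower bound
for `Bad N ∩ Ω`, which combines arithmetic with a Cantor construction.

* Arithmetic (`exists_isProjHyperplane_of_mulHeight_le`, the simplex lemma). If `N + 1` rational
  points of height at most `H` lie in a ball of radius `ρ`, the determinant of their integer
  coordinate vectors is `O(H ^ (N + 1) * ρ ^ N)`. It is an integer, so when this bound is less than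
  `1` the vectors are dependent. Hence for every ball of radius `r` there is a single hyperplane
  containing all rational points `q` with `H(q) ^ τ < κ / r` that lie close to the ball
  (`exists_isProjHyperplane_scale`).
* Geometry (`le_dimH_avoiding`). Given a hyperplane for each ball of radius `ρ * β ^ n`, the decay
  condition says that a neighbourhood of relative width `≍ β` of the hyperplane carries at most half
  of the mass of the ball, if `β` is small. By regularity the rest contains `≍ β ^ (-δ)` points that
  are the centres of well separated balls of radius `ρ * β ^ (n + 1)`. Iterating gives a Cantor set
  in `Ω` which avoids all these neighbourhoods. For `s < δ` and `β` small enough there are at least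
  `β ^ (-s)` children in each step, and the dimension of the Cantor set is at least `s`.

No measure has to be constructed on the Cantor set: when each ball has `K` children, reading
addresses as expansions in base `K` maps the Cantor set onto `[0, 1]`, and this map is
`s`-Hölder (`le_dimH_of_children`).

A point of this Cantor set is badly approximable (`mem_Bad_of_avoiding`): for a rational `q`, take
the first `n` with `H(q) ^ τ * (ρ * β ^ n) < κ`. Then `q` is either far away or on the hyperplane
avoided at scale `n`, so its distance is at least `ρ * β ^ (n + 1)`, which is
`≳ H(q) ^ (-τ)` by the minimality of `n`.
-/

namespace ProjBad

open MeasureTheory Metric Set Filter Topology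
open scoped NNReal Nat

/-! ### The upper bound for the dimension of a regular set -/

/-- If balls of radius `r / 2` centred in `Ω` have mass at least `M`, the number of balls of radius
`r` needed to cover `Ω` is at most the total mass divided by `M`. -/
lemma exists_finset_cover_card_mul_le {X : Type*} [MetricSpace X] [MeasurableSpace X]
    [BorelSpace X] {Ω : Set X} (hΩ : IsCompact Ω) (m : Measure X) {r : ℝ}
    (hr : 0 < r) {M : ℝ≥0∞} (hM : ∀ x ∈ Ω, M ≤ m (closedBall x (r / 2))) :
    ∃ C : Finset X, Ω ⊆ ⋃ x : C, closedBall (x : X) r ∧ C.card * M ≤ m univ := by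
  lift r to ℝ≥0 using hr.le
  have hr' : r / 2 ≠ 0 := (half_pos (NNReal.coe_pos.1 hr)).ne'
  have hfin : packingNumber r Ω ≠ ⊤ := by
    obtain ⟨S, hSΩ, hSf, hS⟩ := exists_finite_isCover_of_isCompact hr' hΩ
    have h1 := packingNumber_two_mul_le_externalCoveringNumber (r / 2) Ω
    rw [mul_div_cancel₀ _ two_ne_zero] at h1
    have h2 : externalCoveringNumber (r / 2) Ω ≤ S.encard := iInf₂_le S hS
    exact ((h1.trans h2).trans_lt hSf.encard_lt_top).ne
  have hCf : (maximalSeparatedSet r Ω).Finite := by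
    rw [← Set.encard_ne_top_iff, encard_maximalSeparatedSet hfin]
    exact hfin
  have hsub : maximalSeparatedSet r Ω ⊆ Ω := maximalSeparatedSet_subset
  have hsep : IsSeparated r (maximalSeparatedSet r Ω) := isSeparated_maximalSeparatedSet
  refine ⟨hCf.toFinset, fun x hx => ?_, ?_⟩
  · obtain ⟨y, hy, hxy⟩ := isCover_maximalSeparatedSet hfin hx
    refine mem_iUnion.2 ⟨⟨y, hCf.mem_toFinset.2 hy⟩, ?_⟩
    have h : edist x y ≤ r := hxy
    rw [mem_closedBall, dist_edist]
    exact ENNReal.toReal_le_coe_of_le_coe h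
  · have hdisj : (↑hCf.toFinset : Set X).PairwiseDisjoint fun x => closedBall x ((r : ℝ) / 2) := by
      intro x hx y hy hxy
      have h : (r : ℝ≥0∞) < edist x y :=
        hsep (hCf.mem_toFinset.1 hx) (hCf.mem_toFinset.1 hy) hxy
      rw [edist_dist, ENNReal.lt_ofReal_iff_toReal_lt ENNReal.coe_ne_top] at h
      apply closedBall_disjoint_closedBall
      simpa using h
    calc (hCf.toFinset.card : ℝ≥0∞) * M = ∑ _x ∈ hCf.toFinset, M := by simp
      _ ≤ ∑ x ∈ hCf.toFinset, m (closedBall x ((r : ℝ) / 2)) :=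
        Finset.sum_le_sum fun x hx => hM x (hsub (hCf.mem_toFinset.1 hx))
      _ = m (⋃ x ∈ hCf.toFinset, closedBall x ((r : ℝ) / 2)) :=
        (measure_biUnion_finset hdisj fun _ _ => measurableSet_closedBall).symm
      _ ≤ m univ := measure_mono (subset_univ _)

theorem dimH_le_of_le_measure_closedBall {X : Type*} [MetricSpace X] [MeasurableSpace X]
    [BorelSpace X] {Ω : Set X} (hΩ : IsCompact Ω) (m : Measure X)
    [IsFiniteMeasure m] {a δ r₀ : ℝ} (ha : 0 < a) (hδ : 0 ≤ δ) (hr₀ : 0 < r₀)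
    (hlow : ∀ x ∈ Ω, ∀ r : ℝ, 0 < r → r < r₀ → ENNReal.ofReal (a * r ^ δ) ≤ m (closedBall x r)) :
    dimH Ω ≤ ENNReal.ofReal δ := by
  set ρ : ℕ → ℝ := fun n => r₀ / (n + 1) with hρ
  have hρ0 : ∀ n, 0 < ρ n := fun n => by simp only [hρ]; positivity
  have hρ1 : ∀ n, ρ n / 2 < r₀ := fun n => by
    have : ρ n ≤ r₀ := div_le_self hr₀.le (by linarith [Nat.cast_nonneg (α := ℝ) n])
    linarith
  have hρt : Tendsto ρ atTop (𝓝 0) := tendsto_const_div_atTop_nhds_zero_nat r₀ |>.comp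
    (tendsto_add_atTop_nat 1) |>.congr fun n => by simp [hρ]
  choose C hcov hcard using fun n => exists_finset_cover_card_mul_le hΩ m (hρ0 n)
    (M := ENNReal.ofReal (a * (ρ n / 2) ^ δ))
    (fun x hx => hlow x hx _ (half_pos (hρ0 n)) (hρ1 n))
  have hsum : ∀ n, ∑ x : C n, ediam (closedBall (x : X) (ρ n)) ^ δ
      ≤ m univ * ENNReal.ofReal (4 ^ δ / a) := by
    intro n
    have hd : ∀ x : X, ediam (closedBall x (ρ n)) ^ δ ≤ ENNReal.ofReal ((2 * ρ n) ^ δ) := by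
      intro x
      rw [← ENNReal.ofReal_rpow_of_nonneg (by have := hρ0 n; positivity) hδ]
      refine ENNReal.rpow_le_rpow (ediam_le fun y hy z hz => ?_) hδ
      rw [edist_dist]
      refine ENNReal.ofReal_le_ofReal ?_
      rw [mem_closedBall] at hy hz
      linarith [dist_triangle_right y z x]
    have hpow : (2 * ρ n) ^ δ = a * (ρ n / 2) ^ δ * (4 ^ δ / a) := by
      rw [show 2 * ρ n = 4 * (ρ n / 2) by ring,
        Real.mul_rpow (by norm_num) (half_pos (hρ0 n)).le]
      field_simp
    calc ∑ x : C n, ediam (closedBall (x : X) (ρ n)) ^ δ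
        ≤ ∑ _x : C n, ENNReal.ofReal ((2 * ρ n) ^ δ) := Finset.sum_le_sum fun x _ => hd x
      _ = (C n).card * ENNReal.ofReal (a * (ρ n / 2) ^ δ) * ENNReal.ofReal (4 ^ δ / a) := by
        rw [hpow, ENNReal.ofReal_mul (by have := hρ0 n; positivity)]
        simp [mul_assoc]
      _ ≤ m univ * ENNReal.ofReal (4 ^ δ / a) := by gcongr; exact hcard n
  have hle : μH[δ] Ω ≤ m univ * ENNReal.ofReal (4 ^ δ / a) := by
    refine (Measure.hausdorffMeasure_le_liminf_sum δ Ω (l := atTop)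
      (fun n => ENNReal.ofReal (2 * ρ n)) ?_ (fun n (x : C n) => closedBall (x : X) (ρ n))
      (Eventually.of_forall fun n x => ?_) (Eventually.of_forall hcov)).trans ?_
    · have := ENNReal.tendsto_ofReal (hρt.const_mul 2)
      simpa using this
    · refine ediam_le fun y hy z hz => ?_
      rw [edist_dist]
      refine ENNReal.ofReal_le_ofReal ?_
      rw [mem_closedBall] at hy hz
      linarith [dist_triangle_right y z (x : X)]
    · exact (liminf_le_liminf (Eventually.of_forall hsum)).trans (by simp)
  have hne : μH[((⟨δ, hδ⟩ : ℝ≥0) : ℝ)] Ω ≠ ∞ :=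
    (hle.trans_lt (ENNReal.mul_lt_top (measure_lt_top m _) ENNReal.ofReal_lt_top)).ne
  refine (dimH_le_of_hausdorffMeasure_ne_top hne).trans (le_of_eq ?_)
  rw [ENNReal.ofReal, Real.toNNReal_of_nonneg hδ]
  rfl

/-! ### Separated children avoiding an obstacle -/

/-- Greedy choice: as long as fewer than `K` points have been chosen, the balls around them do not
exhaust `T`. -/
lemma exists_separated_family {X : Type*} [MetricSpace X] [MeasurableSpace X]
    (m : Measure X) {T : Set X} {M : ℝ≥0∞} {ρ : ℝ}
    (hM : ∀ x ∈ T, m (closedBall x ρ) ≤ M) (K : ℕ) (hK : K * M < m T) :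
    ∃ f : Fin K → X, (∀ i, f i ∈ T) ∧ ∀ i j, i ≠ j → ρ < dist (f i) (f j) := by
  induction K with
  | zero => exact ⟨Fin.elim0, fun i => i.elim0, fun i => i.elim0⟩
  | succ K ih =>
    have hK' : K * M < m T := lt_of_le_of_lt (by gcongr; simp) hK
    obtain ⟨f, hfT, hfs⟩ := ih hK'
    obtain ⟨x, hxT, hx⟩ : ∃ x ∈ T, x ∉ ⋃ i, closedBall (f i) ρ := by
      by_contra! hcon
      have : m T ≤ K * M := calc
        m T ≤ m (⋃ i, closedBall (f i) ρ) := measure_mono hcon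
        _ ≤ ∑ i, m (closedBall (f i) ρ) := measure_iUnion_fintype_le _ _
        _ ≤ ∑ _i : Fin K, M := Finset.sum_le_sum fun i _ => hM _ (hfT i)
        _ = K * M := by simp
      exact absurd hK' this.not_gt
    have hx' : ∀ i, ρ < dist x (f i) := by simpa using hx
    refine ⟨Fin.cons x f, fun i => ?_, fun i j => ?_⟩
    · cases i using Fin.cases <;> simp [hxT, hfT]
    · cases i using Fin.cases <;> cases j using Fin.cases
      · simp
      · intro _; simpa using hx' _
      · intro _; simpa [dist_comm] using hx' _
      · intro h; simpa using hfs _ _ (fun h' => h (by rw [h']))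

/-- One step of the Cantor construction. Half of the mass of `closedBall x (r / 2)` lies outside the
neighbourhood of the obstacle `P`, and this leaves room for `K` separated points. The neighbourhood
has width `2 * β * r` so that whole balls of radius `β * r` around the new points stay away from
`P`, and the separation `3 * (β * r)` keeps these balls at distance at least `β * r` from each
other. -/
lemma exists_children {X : Type*} [MetricSpace X] [MeasurableSpace X] {Ω : Set X}
    (m : Measure X) [IsFiniteMeasure m] (hsupp : m Ωᶜ = 0) {a b δ r₀ β r : ℝ} {K : ℕ}
    {P : Set X} {x : X} (hb : 0 < b)
    (hreg : ∀ x ∈ Ω, ∀ r : ℝ, 0 < r → r < r₀ →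
      ENNReal.ofReal (a * r ^ δ) ≤ m (closedBall x r) ∧
      m (closedBall x r) ≤ ENNReal.ofReal (b * r ^ δ))
    (hβ : 0 < β) (hβ3 : 3 * β ≤ 1) (hr : 0 < r) (hr₀ : r < r₀) (hx : x ∈ Ω)
    (hK : K * (b * (3 * β) ^ δ) < a * (1 / 2) ^ δ / 2)
    (hP : m (closedBall x (r / 2) ∩ thickening (2 * β * r) P)
      ≤ ENNReal.ofReal (1 / 2) * m (closedBall x (r / 2))) :
    ∃ f : Fin K → X, (∀ i, f i ∈ Ω ∧ dist (f i) x ≤ r / 2 ∧ f i ∉ thickening (2 * β * r) P) ∧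
      ∀ i j, i ≠ j → 3 * (β * r) < dist (f i) (f j) := by
  set B := closedBall x (r / 2)
  set U := thickening (2 * β * r) P
  have hlow : ENNReal.ofReal (a * (r / 2) ^ δ) ≤ m B := (hreg x hx _ (by linarith) (by linarith)).1
  have hhalf : ENNReal.ofReal (1 / 2) * m B ≤ m ((B \ U) ∩ Ω) := by
    have h1 : m (B \ U) ≤ m ((B \ U) ∩ Ω) := by
      rw [← measure_inter_add_sdiff₀ (B \ U) (t := Ω)]
      · have : m ((B \ U) \ Ω) = 0 := measure_mono_null (fun y hy => hy.2) hsupp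
        rw [this, add_zero]
      · exact (NullMeasurableSet.of_compl (NullMeasurableSet.of_null hsupp))
    have h2 : m B ≤ m (B ∩ U) + m (B \ U) := measure_le_inter_add_sdiff m B U
    have h3 : ENNReal.ofReal (1 / 2) * m B + ENNReal.ofReal (1 / 2) * m B = m B := by
      rw [← add_mul, ← ENNReal.ofReal_add (by norm_num) (by norm_num)]
      norm_num
    refine le_trans ?_ h1
    have hfin : ENNReal.ofReal (1 / 2) * m B ≠ ∞ :=
      (ENNReal.mul_lt_top ENNReal.ofReal_lt_top (measure_lt_top m B)).ne
    refine (ENNReal.add_le_add_iff_left hfin).1 ?_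
    rw [h3]
    exact h2.trans (by gcongr)
  have hKM : K * ENNReal.ofReal (b * (3 * (β * r)) ^ δ) < m ((B \ U) ∩ Ω) := by
    refine lt_of_lt_of_le ?_ ((mul_le_mul_right hlow _).trans hhalf)
    rw [← ENNReal.ofReal_natCast, ← ENNReal.ofReal_mul (by positivity),
      ← ENNReal.ofReal_mul (by norm_num)]
    have h1 : (3 * (β * r)) ^ δ = (3 * β) ^ δ * r ^ δ := by
      rw [← mul_assoc, Real.mul_rpow (by positivity) hr.le]
    have h2 : (r / 2) ^ δ = (1 / 2) ^ δ * r ^ δ := by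
      rw [← Real.mul_rpow (by positivity) hr.le]; congr 1; ring
    have hrδ : 0 < r ^ δ := by positivity
    have h3 : (K : ℝ) * (b * (3 * (β * r)) ^ δ) < 1 / 2 * (a * (r / 2) ^ δ) := by
      rw [h1, h2]
      nlinarith [mul_lt_mul_of_pos_right hK hrδ]
    refine (ENNReal.ofReal_lt_ofReal_iff (lt_of_le_of_lt ?_ h3)).2 h3
    positivity
  obtain ⟨f, hf, hsep⟩ := exists_separated_family m (T := (B \ U) ∩ Ω) (ρ := 3 * (β * r))
    (fun y hy => (hreg y hy.2 _ (by positivity) (by nlinarith)).2) K hKM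
  exact ⟨f, fun i => ⟨(hf i).2, (hf i).1.1, (hf i).1.2⟩, hsep⟩

/-! ### The dimension of a Cantor set -/

/-- The centre of the ball of generation `n` with a given address: the digit `ω n` selects one of
the children of the ball of generation `n`. -/
def branch {X : Type*} {K : ℕ} (child : ℕ → X → Fin K → X) (x₀ : X) (ω : ℕ → Fin K) : ℕ → X
  | 0 => x₀
  | n + 1 => child n (branch child x₀ ω n) (ω n)

lemma branch_congr {X : Type*} {K : ℕ} (child : ℕ → X → Fin K → X) (x₀ : X) {ω ω' : ℕ → Fin K}
    {n : ℕ} (h : ∀ i < n, ω i = ω' i) : branch child x₀ ω n = branch child x₀ ω' n := by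
  induction n with
  | zero => rfl
  | succ n ih => rw [branch, branch, ih fun i hi => h i (by omega), h n (by omega)]

/-- A Cantor set in which every ball of radius `ρ * β ^ n` has `K ≥ β ^ (-s)` separated children of
radius `ρ * β ^ (n + 1)` has dimension at least `s`. -/
theorem le_dimH_of_children {X : Type*} [MetricSpace X] {Ω : Set X} (hΩ : IsCompact Ω)
    {ρ β s : ℝ} {K : ℕ} (hρ : 0 < ρ) (hβ : 0 < β) (hβ2 : β ≤ 1 / 2) (hs : 0 < s)
    (hK : β⁻¹ ^ s ≤ K) (child : ℕ → X → Fin K → X) {x₀ : X} (hx₀ : x₀ ∈ Ω)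
    (hchild : ∀ n, ∀ x ∈ Ω, ∀ i, child n x i ∈ Ω ∧ dist (child n x i) x ≤ ρ * β ^ n / 2)
    (hsep : ∀ n, ∀ x ∈ Ω, ∀ i j, i ≠ j →
      3 * (ρ * β ^ (n + 1)) < dist (child n x i) (child n x j)) :
    ENNReal.ofReal s ≤ dimH {x ∈ Ω | ∀ n, ∃ y ∈ Ω, dist x y ≤ ρ * β ^ n ∧
      ∃ i, dist x (child n y i) ≤ ρ * β ^ (n + 1)} := by
  set F := {x ∈ Ω | ∀ n, ∃ y ∈ Ω, dist x y ≤ ρ * β ^ n ∧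
      ∃ i, dist x (child n y i) ≤ ρ * β ^ (n + 1)}
  have hK1 : 1 < K := by
    have : (1 : ℝ) < β⁻¹ ^ s := Real.one_lt_rpow (one_lt_inv₀ hβ |>.2 (by linarith)) hs
    exact_mod_cast this.trans_le hK
  let B := branch child x₀
  have hBΩ : ∀ ω n, B ω n ∈ Ω := by
    intro ω n
    induction n with
    | zero => exact hx₀
    | succ n ih => exact (hchild n _ ih _).1
  have hstep : ∀ ω n, dist (B ω n) (B ω (n + 1)) ≤ ρ / 2 * β ^ n := by
    intro ω n
    rw [dist_comm]
    exact (hchild n _ (hBΩ ω n) (ω n)).2.trans (by linarith)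
  have hlim : ∀ ω, ∃ x ∈ Ω, Tendsto (B ω) atTop (𝓝 x) := fun ω =>
    cauchySeq_tendsto_of_isComplete hΩ.isComplete (hBΩ ω)
      (cauchySeq_of_le_geometric β (ρ / 2) (by linarith) (hstep ω))
  choose π hπΩ hπ using hlim
  have hdist : ∀ ω n, dist (π ω) (B ω n) ≤ ρ * β ^ n := by
    intro ω n
    rw [dist_comm]
    refine (dist_le_of_le_geometric_of_tendsto β (ρ / 2) (by linarith) (hstep ω) (hπ ω) n).trans ?_
    rw [div_le_iff₀ (by linarith)]
    have : 0 < ρ * β ^ n := by positivity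
    nlinarith
  have hπF : ∀ ω, π ω ∈ F := fun ω =>
    ⟨hπΩ ω, fun n => ⟨B ω n, hBΩ ω n, hdist ω n, ω n, hdist ω (n + 1)⟩⟩
  -- If two addresses first differ at place `n`, their limits are separated at scale `n + 1`.
  have hfirst : ∀ ω ω' : ℕ → Fin K, ω ≠ ω' → ∃ n, (∀ i < n, ω i = ω' i) ∧
      ρ * β ^ (n + 1) ≤ dist (π ω) (π ω') := by
    intro ω ω' h
    have hex : ∃ n, ω n ≠ ω' n := Function.ne_iff.1 h
    classical
    refine ⟨Nat.find hex, fun i hi => not_not.1 (Nat.find_min hex hi), ?_⟩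
    set n := Nat.find hex
    have hn : ω n ≠ ω' n := Nat.find_spec hex
    have heq : B ω n = B ω' n :=
      branch_congr child x₀ fun i hi => not_not.1 (Nat.find_min hex hi)
    have h1 : 3 * (ρ * β ^ (n + 1)) < dist (B ω (n + 1)) (B ω' (n + 1)) := by
      change _ < dist (child n (B ω n) (ω n)) (child n (B ω' n) (ω' n))
      rw [← heq]
      exact hsep n _ (hBΩ ω n) _ _ hn
    have h2 := hdist ω (n + 1)
    have h3 := hdist ω' (n + 1)
    have h4 := dist_triangle4 (B ω (n + 1)) (π ω) (π ω') (B ω' (n + 1))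
    rw [dist_comm (B ω (n + 1)) (π ω)] at h4
    linarith
  have hinj : Function.Injective π := by
    intro ω ω' h
    by_contra hne
    obtain ⟨n, -, hn⟩ := hfirst ω ω' hne
    rw [h, dist_self] at hn
    have : 0 < ρ * β ^ (n + 1) := by positivity
    linarith
  have hne : Nonempty (ℕ → Fin K) := ⟨fun _ => ⟨0, by omega⟩⟩
  -- The address of a point of the Cantor set, read as an expansion in base `K`.
  let g : X → ℝ := fun x => Real.ofDigits (Function.invFun π x)
  have hg : ∀ ω, g (π ω) = Real.ofDigits ω := fun ω => by
    simp only [g, Function.leftInverse_invFun hinj ω]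
  have hC0 : 0 < (ρ * β) ^ s := by positivity
  have hholder : HolderOnWith ((ρ * β) ^ s)⁻¹.toNNReal s.toNNReal g (range π) := by
    rintro _ ⟨ω, rfl⟩ _ ⟨ω', rfl⟩
    rw [hg, hg, edist_dist, edist_dist, Real.coe_toNNReal s hs.le,
      ENNReal.ofReal_rpow_of_nonneg dist_nonneg hs.le]
    change _ ≤ ENNReal.ofReal _ * _
    rw [← ENNReal.ofReal_mul (by positivity)]
    refine ENNReal.ofReal_le_ofReal ?_
    by_cases h : ω = ω'
    · subst h
      rw [dist_self]
      positivity
    obtain ⟨n, hn, hd⟩ := hfirst ω ω' h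
    calc dist (Real.ofDigits ω) (Real.ofDigits ω') ≤ ((K : ℝ) ^ n)⁻¹ :=
          Real.abs_ofDigits_sub_ofDigits_le hn
      _ ≤ ((β⁻¹ ^ s) ^ n)⁻¹ := by gcongr
      _ = ((ρ * β) ^ s)⁻¹ * (ρ * β ^ (n + 1)) ^ s := by
        rw [pow_succ', ← mul_assoc, Real.mul_rpow (x := ρ * β) (by positivity) (by positivity),
          inv_mul_cancel_left₀ hC0.ne', Real.inv_rpow hβ.le, inv_pow, inv_inv,
          Real.rpow_pow_comm hβ.le]
      _ ≤ _ := by gcongr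
  have himage : Icc (0 : ℝ) 1 ⊆ g '' range π := by
    intro t ht
    obtain ⟨ω, -, rfl⟩ := Real.ofDigits_SurjOn hK1 ht
    exact ⟨π ω, mem_range_self ω, hg ω⟩
  have hs' : 0 < s.toNNReal := Real.toNNReal_pos.2 hs
  have h1 : (1 : ℝ≥0∞) ≤ dimH (range π) / s.toNNReal := by
    refine le_trans ?_ ((dimH_mono himage).trans (hholder.dimH_image_le hs'))
    rw [Real.dimH_of_nonempty_interior (by simp)]
    simp
  rw [ENNReal.le_div_iff_mul_le (Or.inl (by simpa using hs)) (Or.inl ENNReal.coe_ne_top),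
    one_mul] at h1
  exact h1.trans (dimH_mono (range_subset_iff.2 hπF))

/-- Let `𝓗` be a family of obstacles for which `m` is absolutely decaying. Whichever obstacle `P n y`
is assigned to the ball of radius `ρ * β ^ n` around `y`, the points of `Ω` which at every scale
stay away from the obstacle of a nearby ball form a set of dimension at least `s`, for any `s < δ`.
The parameters `β` and `ρ` do not depend on the assignment. -/
theorem le_dimH_avoiding {X : Type*} [MetricSpace X] [MeasurableSpace X] {Ω : Set X}
    (hΩ : IsCompact Ω) (hne : Ω.Nonempty) (m : Measure X) [IsFiniteMeasure m] (hsupp : m Ωᶜ = 0)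
    {a b c δ η s r₀ : ℝ} (ha : 0 < a) (hb : 0 < b) (hs : 0 < s) (hsδ : s < δ) (hη : 0 < η)
    (hr₀ : 0 < r₀)
    (hreg : ∀ x ∈ Ω, ∀ r : ℝ, 0 < r → r < r₀ →
      ENNReal.ofReal (a * r ^ δ) ≤ m (closedBall x r) ∧
      m (closedBall x r) ≤ ENNReal.ofReal (b * r ^ δ))
    {𝓗 : Set (Set X)}
    (hdec : ∀ P ∈ 𝓗, ∀ ε : ℝ, 0 < ε → ∀ x ∈ Ω, ∀ r : ℝ, 0 < r → r < r₀ →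
      m (closedBall x r ∩ thickening ε P) ≤ ENNReal.ofReal (c * (ε / r) ^ η) * m (closedBall x r)) :
    ∃ β ρ : ℝ, 0 < β ∧ β < 1 ∧ 0 < ρ ∧ ∀ P : ℕ → X → Set X, (∀ n x, P n x ∈ 𝓗) →
      ENNReal.ofReal s ≤ dimH {x ∈ Ω | ∀ n, ∃ y, dist x y ≤ ρ * β ^ n ∧
        x ∉ thickening (ρ * β ^ (n + 1)) (P n y)} := by
  have hδ : 0 < δ := hs.trans hsδ
  -- The last condition makes room for `⌈β⁻¹ ^ s⌉` children. It holds for small `β` because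
  -- `β⁻¹ ^ s * β ^ δ = β ^ (δ - s)` tends to `0`.
  obtain ⟨β, hβ0, hβ3, hβη, hβK⟩ : ∃ β : ℝ, 0 < β ∧ 3 * β ≤ 1 ∧ c * (4 * β) ^ η ≤ 1 / 2 ∧
      (β⁻¹ ^ s + 1) * (b * (3 * β) ^ δ) < a * (1 / 2) ^ δ / 2 := by
    have t1 : Tendsto (fun β : ℝ => c * (4 * β) ^ η) (𝓝[>] 0) (𝓝 0) := by
      have : ContinuousAt (fun β : ℝ => c * (4 * β) ^ η) 0 :=
        continuousAt_const.mul ((continuousAt_const.mul continuousAt_id).rpow_const (Or.inr hη.le))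
      simpa [ContinuousAt, Real.zero_rpow hη.ne'] using this.tendsto.mono_left nhdsWithin_le_nhds
    have t2 : Tendsto (fun β : ℝ => b * 3 ^ δ * (β ^ (δ - s) + β ^ δ)) (𝓝[>] 0) (𝓝 0) := by
      have : ContinuousAt (fun β : ℝ => b * 3 ^ δ * (β ^ (δ - s) + β ^ δ)) 0 :=
        continuousAt_const.mul ((continuousAt_id.rpow_const (Or.inr (by simp; linarith))).add
          (continuousAt_id.rpow_const (Or.inr hδ.le)))
      simpa [ContinuousAt, Real.zero_rpow hδ.ne', Real.zero_rpow (sub_pos.2 hsδ).ne'] using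
        this.tendsto.mono_left nhdsWithin_le_nhds
    have e3 : ∀ᶠ β : ℝ in 𝓝[>] 0, β < 1 / 3 :=
      (eventually_lt_nhds (by norm_num)).filter_mono nhdsWithin_le_nhds
    have e1 := t1.eventually_lt_const (show (0 : ℝ) < 1 / 2 by norm_num)
    have e2 := t2.eventually_lt_const (show (0 : ℝ) < a * (1 / 2) ^ δ / 2 by positivity)
    obtain ⟨β, ⟨h1, h2, h3⟩, h0⟩ :=
      ((e1.and (e2.and e3)).and self_mem_nhdsWithin).exists
    have h0 : 0 < β := h0
    refine ⟨β, h0, by linarith, h1.le, lt_of_eq_of_lt ?_ h2⟩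
    rw [Real.mul_rpow (by norm_num) h0.le, Real.rpow_sub h0, Real.inv_rpow h0.le]
    ring
  obtain ⟨x₀, hx₀⟩ := hne
  refine ⟨β, r₀ / 2, hβ0, by linarith, by positivity, fun P hP => ?_⟩
  set ρ := r₀ / 2 with hρ
  have hρ0 : 0 < ρ := half_pos hr₀
  have hr : ∀ n, 0 < ρ * β ^ n := fun n => by positivity
  have hr' : ∀ n, ρ * β ^ n < r₀ := fun n => by
    have : β ^ n ≤ 1 := pow_le_one₀ hβ0.le (by linarith)
    nlinarith
  have hKle := Nat.le_ceil (β⁻¹ ^ s)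
  have hKlt : (⌈β⁻¹ ^ s⌉₊ : ℝ) < β⁻¹ ^ s + 1 := Nat.ceil_lt_add_one (by positivity)
  set K := ⌈β⁻¹ ^ s⌉₊
  have hchild : ∀ n x, ∃ f : Fin K → X, x ∈ Ω →
      (∀ i, f i ∈ Ω ∧ dist (f i) x ≤ ρ * β ^ n / 2 ∧
        f i ∉ thickening (2 * β * (ρ * β ^ n)) (P n x)) ∧
      ∀ i j, i ≠ j → 3 * (β * (ρ * β ^ n)) < dist (f i) (f j) := by
    intro n x
    by_cases hx : x ∈ Ω
    · have hd := hdec _ (hP n x) (2 * β * (ρ * β ^ n)) (by have := hr n; positivity) x hx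
        (ρ * β ^ n / 2) (half_pos (hr n)) (by linarith [hr n, hr' n])
      have h4 : 2 * β * (ρ * β ^ n) / (ρ * β ^ n / 2) = 4 * β := by
        have := (hr n).ne'
        field_simp
        ring
      rw [h4] at hd
      obtain ⟨f, hf⟩ := exists_children m hsupp hb hreg hβ0 hβ3 (hr n) (hr' n) hx
        (K := K) (P := P n x) (lt_of_le_of_lt (by gcongr) hβK)
        (hd.trans (by gcongr))
      exact ⟨f, fun _ => hf⟩
    · exact ⟨fun _ => x, fun h => absurd h hx⟩
  choose child hc using hchild
  refine (le_dimH_of_children hΩ hρ0 hβ0 (by linarith) hs hKle child hx₀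
    (fun n x hx i => ⟨((hc n x hx).1 i).1, ((hc n x hx).1 i).2.1⟩)
    (fun n x hx i j hij => ?_)).trans (dimH_mono ?_)
  · have := (hc n x hx).2 i j hij
    rwa [pow_succ', mul_left_comm ρ]
  -- A point within `β * (ρ * β ^ n)` of a child inherits half of the child's distance to `P n y`.
  · rintro x ⟨hxΩ, hx⟩
    refine ⟨hxΩ, fun n => ?_⟩
    obtain ⟨y, hy, hxy, i, hi⟩ := hx n
    refine ⟨y, hxy, fun hmem => ((hc n y hy).1 i).2.2 ?_⟩
    obtain ⟨z, hz, hxz⟩ := mem_thickening_iff.1 hmem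
    refine mem_thickening_iff.2 ⟨z, hz, ?_⟩
    have h1 := dist_triangle_left (child n y i) z x
    have h2 : ρ * β ^ (n + 1) = β * (ρ * β ^ n) := by ring
    linarith

/-! ### The simplex lemma -/

lemma abs_det_le_factorial_mul_prod {n : Type*} [Fintype n] [DecidableEq n] (A : Matrix n n ℝ)
    (x : n → ℝ) (h : ∀ i j, |A i j| ≤ x i) : |A.det| ≤ (Fintype.card n)! * ∏ i, x i := by
  rw [Matrix.det_apply]
  calc |∑ σ : Equiv.Perm n, Equiv.Perm.sign σ • ∏ i, A (σ i) i|
      ≤ ∑ σ : Equiv.Perm n, |Equiv.Perm.sign σ • ∏ i, A (σ i) i| :=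
        Finset.abs_sum_le_sum_abs _ _
    _ ≤ ∑ _σ : Equiv.Perm n, ∏ i, x i := by
        refine Finset.sum_le_sum fun σ _ => ?_
        have h1 : |Equiv.Perm.sign σ • ∏ i, A (σ i) i| = ∏ i, |A (σ i) i| := by
          rw [← Finset.abs_prod]
          rcases Int.units_eq_one_or (Equiv.Perm.sign σ) with h | h <;> simp [h]
        rw [h1, ← Equiv.prod_comp σ x]
        exact Finset.prod_le_prod (fun i _ => abs_nonneg _) fun i _ => h _ _
    _ = (Fintype.card n)! * ∏ i, x i := by simp [Fintype.card_perm]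

/-- The real vector with the given integer coordinates. -/
noncomputable def intVec {N : ℕ} (z : Fin (N + 1) → ℤ) : EuclideanSpace ℝ (Fin (N + 1)) :=
  WithLp.toLp 2 fun i => (z i : ℝ)

/-- A rational point has integer coordinates bounded by its height, namely coprime ones. -/
lemma exists_intVec_rep {N : ℕ} (q : RatProj N) :
    ∃ (z : Fin (N + 1) → ℤ) (h : intVec z ≠ 0), ratPoint q = Projectivization.mk ℝ (intVec z) h ∧
      ∀ i, |(z i : ℝ)| ≤ q.mulHeight := by
  set v := q.rep
  have hv0 : v ≠ 0 := q.rep_nonzero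
  obtain ⟨⟨D, hD⟩, hDv⟩ := IsLocalization.exist_integer_multiples (nonZeroDivisors ℤ)
    (Finset.univ : Finset (Fin (N + 1))) v
  choose w hw using fun i => hDv i (Finset.mem_univ i)
  have hD0 : (D : ℚ) ≠ 0 := by exact_mod_cast nonZeroDivisors.ne_zero hD
  have hwv : ∀ i, (w i : ℚ) = D * v i := fun i => by
    have := hw i
    simpa [Submonoid.smul_def] using this
  obtain ⟨z, hz, hgcd⟩ := Finset.extract_gcd w (Finset.univ_nonempty (α := Fin (N + 1)))
  set g := Finset.univ.gcd w
  have hvz : ∀ i, (D : ℚ) * v i = g * z i := fun i => by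
    rw [← hwv, hz i (Finset.mem_univ i)]; push_cast; rfl
  have hz0 : (fun i => (z i : ℚ)) ≠ 0 := by
    intro h
    apply hv0
    funext i
    have h1 := hvz i
    have h2 : (z i : ℚ) = 0 := congrFun h i
    rw [h2, mul_zero] at h1
    exact (mul_eq_zero.1 h1).resolve_left hD0
  have hq : q = Projectivization.mk ℚ (fun i => (z i : ℚ)) hz0 := by
    rw [← q.mk_rep, Projectivization.mk_eq_mk_iff']
    refine ⟨g / D, ?_⟩
    funext i
    have := hvz i
    simp only [Pi.smul_apply, smul_eq_mul]
    rw [div_mul_eq_mul_div, ← this]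
    field_simp
    rfl
  have hzz : ratVec N (fun i => (z i : ℚ)) = intVec z := by
    ext i
    simp [ratVec, intVec]
  have hr0 : intVec z ≠ 0 := by
    rw [← hzz]
    exact fun h => hz0 (ratVec_injective N (by rw [h, map_zero]))
  refine ⟨z, hr0, ?_, fun i => ?_⟩
  · rw [hq, ratPoint, Projectivization.map_mk]
    congr
  · rw [hq, ratProj_mulHeight z hgcd hz0]
    have : |z i| ≤ ⨆ i, |z i| := le_ciSup (Finite.bddAbove_range fun i => |z i|) i
    exact_mod_cast this

lemma abs_minor_le_wedgeNorm {N : ℕ} (x y : EuclideanSpace ℝ (Fin (N + 1))) (i j : Fin (N + 1)) :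
    |x i * y j - x j * y i| ≤ wedgeNorm x y := by
  have key : ∀ i j : Fin (N + 1), i < j → |x i * y j - x j * y i| ≤ wedgeNorm x y := by
    intro i j hij
    refine Real.abs_le_sqrt ?_
    refine le_trans ?_ (Finset.single_le_sum (f := fun i => ∑ j ∈ Finset.Ioi i,
      (x i * y j - x j * y i) ^ 2) (fun _ _ => by positivity) (Finset.mem_univ i))
    exact Finset.single_le_sum (f := fun j => (x i * y j - x j * y i) ^ 2)
      (fun _ _ => by positivity) (Finset.mem_Ioi.2 hij)
  rcases lt_trichotomy i j with h | h | h
  · exact key i j h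
  · subst h
    simp [wedgeNorm]
  · rw [abs_sub_comm]
    simpa [mul_comm] using key j i h

lemma norm_le_sqrt_mul {N : ℕ} {x : EuclideanSpace ℝ (Fin (N + 1))} {M : ℝ} (hM : 0 ≤ M)
    (h : ∀ i, |x i| ≤ M) : ‖x‖ ≤ Real.sqrt (N + 1) * M := by
  rw [EuclideanSpace.norm_eq, ← Real.sqrt_sq hM, ← Real.sqrt_mul (by positivity)]
  refine Real.sqrt_le_sqrt ?_
  calc ∑ i, ‖x i‖ ^ 2 ≤ ∑ _i : Fin (N + 1), M ^ 2 :=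
        Finset.sum_le_sum fun i _ => pow_le_pow_left₀ (norm_nonneg _) (h i) 2
    _ = _ := by simp

/-- If all rows are within projective distance `ρ` of the first one, every row but the first
contributes an extra factor `ρ` to the determinant. -/
lemma abs_det_le_of_wedgeNorm_le {N : ℕ} (A : Fin (N + 1) → EuclideanSpace ℝ (Fin (N + 1)))
    {H ρ : ℝ} (hρ : 0 ≤ ρ) (hH : ∀ i j, |A i j| ≤ H) (h0 : A 0 ≠ 0)
    (hw : ∀ i, wedgeNorm (A 0) (A i) ≤ ρ * (‖A 0‖ * ‖A i‖)) :
    |(Matrix.of fun i j => A i j).det| ≤ (N + 1)! * (H * ((N + 1) * H * ρ) ^ N) := by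
  -- Dividing by the largest entry of row `0` is what cancels the factor `‖A 0‖` below.
  obtain ⟨k, -, hk⟩ := Finset.exists_max_image Finset.univ (fun j => |A 0 j|)
    (Finset.univ_nonempty (α := Fin (N + 1)))
  have hk' : ∀ j, |A 0 j| ≤ |A 0 k| := fun j => hk j (Finset.mem_univ j)
  have hH0 : 0 ≤ H := (abs_nonneg _).trans (hH 0 0)
  have hk0 : A 0 k ≠ 0 := by
    intro h
    apply h0
    ext j
    have := hk' j
    rw [h, abs_zero] at this
    simpa using this
  -- Subtracting multiples of row `0` clears column `k` and turns the other entries into minors.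
  let c : Fin (N + 1) → ℝ := fun i => if i = 0 then 0 else A i k / A 0 k
  let B : Matrix (Fin (N + 1)) (Fin (N + 1)) ℝ := Matrix.of fun i j => A i j - c i * A 0 j
  have hB0 : ∀ j, B 0 j = A 0 j := fun j => by simp [B, c]
  have hdet : (Matrix.of fun i j => A i j).det = B.det :=
    Matrix.det_eq_of_forall_row_eq_smul_add_const c 0 (by simp [c]) fun i j => by
      rw [hB0]; simp [B]
  have hsq : Real.sqrt (N + 1) * Real.sqrt (N + 1) = N + 1 := Real.mul_self_sqrt (by positivity)
  have hBs : ∀ (i : Fin N) j, |B i.succ j| ≤ (N + 1) * H * ρ := by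
    intro i j
    have e : B i.succ j = (A 0 k * A i.succ j - A 0 j * A i.succ k) / A 0 k := by
      simp only [B, c, Matrix.of_apply, Fin.succ_ne_zero, if_false]
      field_simp
    rw [e, abs_div, div_le_iff₀ (abs_pos.2 hk0)]
    calc |A 0 k * A i.succ j - A 0 j * A i.succ k| ≤ wedgeNorm (A 0) (A i.succ) :=
          abs_minor_le_wedgeNorm _ _ _ _
      _ ≤ ρ * (‖A 0‖ * ‖A i.succ‖) := hw _
      _ ≤ ρ * ((Real.sqrt (N + 1) * |A 0 k|) * (Real.sqrt (N + 1) * H)) := by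
          gcongr
          · exact norm_le_sqrt_mul (abs_nonneg _) hk'
          · exact norm_le_sqrt_mul hH0 (hH _)
      _ = (N + 1) * H * ρ * |A 0 k| := by linear_combination (ρ * |A 0 k| * H) * hsq
  rw [hdet]
  refine (abs_det_le_factorial_mul_prod B (Fin.cons H fun _ => (N + 1) * H * ρ) fun i j => ?_).trans
    (le_of_eq ?_)
  · cases i using Fin.cases with
    | zero => simpa [hB0] using hH 0 j
    | succ i => simpa using hBs i j
  · simp [Fin.prod_univ_succ]

lemma exists_finrank_eq_of_lt_top {N : ℕ} {W : Submodule ℝ (EuclideanSpace ℝ (Fin (N + 1)))}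
    (hW : W ≠ ⊤) :
    ∃ L : Submodule ℝ (EuclideanSpace ℝ (Fin (N + 1))), Module.finrank ℝ L = N ∧ W ≤ L := by
  obtain ⟨f, hf, hWf⟩ := Submodule.exists_le_ker_of_lt_top W hW.lt_top
  refine ⟨LinearMap.ker f, ?_, hWf⟩
  have h1 := LinearMap.finrank_range_add_finrank_ker f
  rw [LinearMap.range_eq_top.2 (LinearMap.surjective hf)] at h1
  simp at h1
  omega

/-- The simplex lemma: rational points of bounded height in a small ball lie on a hyperplane. -/
theorem exists_isProjHyperplane_of_mulHeight_le {N : ℕ} {H ρ : ℝ} (hρ : 0 ≤ ρ)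
    (hsmall : (N + 1)! * (H * ((N + 1) * H * (2 * ρ)) ^ N) < 1) (y : RealProj N) :
    ∃ P : Set (RealProj N), IsProjHyperplane P ∧
      ∀ q : RatProj N, q.mulHeight ≤ H → dist (ratPoint q) y ≤ ρ → ratPoint q ∈ P := by
  choose z hz0 hz hzH using fun q : RatProj N => exists_intVec_rep q
  let S : Set (EuclideanSpace ℝ (Fin (N + 1))) :=
    {v | ∃ q : RatProj N, q.mulHeight ≤ H ∧ dist (ratPoint q) y ≤ ρ ∧ v = intVec (z q)}
  have hspan : Submodule.span ℝ S ≠ ⊤ := by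
    intro htop
    have hcard : Module.finrank ℝ (Submodule.span ℝ S) = N + 1 := by
      rw [htop, finrank_top, finrank_euclideanSpace_fin]
    obtain ⟨f', hf', -, hli'⟩ := Submodule.exists_fun_fin_finrank_span_eq ℝ S
    choose p hpH hpy hp using hf'
    set w : Fin (N + 1) → Fin (N + 1) → ℤ := fun i => z (p (Fin.cast hcard.symm i))
    have hli : LinearIndependent ℝ fun i => intVec (w i) := by
      have h := hli'.comp _ (Fin.cast_injective hcard.symm)
      have e : f' ∘ Fin.cast hcard.symm = fun i => intVec (w i) := funext fun i => hp _
      rwa [e] at h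
    set A : Matrix (Fin (N + 1)) (Fin (N + 1)) ℝ := Matrix.of fun i j => intVec (w i) j
    have hdet0 : A.det ≠ 0 := by
      have h : LinearIndependent ℝ A.row :=
        hli.map' (WithLp.linearEquiv 2 ℝ (Fin (N + 1) → ℝ)).toLinearMap (LinearEquiv.ker _)
      exact ((Matrix.isUnit_iff_isUnit_det A).1
        (Matrix.linearIndependent_rows_iff_isUnit.1 h)).ne_zero
    have hdetZ : A.det = ((Matrix.of w).det : ℝ) := by
      rw [Int.cast_det]
      rfl
    have h1 : (1 : ℝ) ≤ |A.det| := by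
      rw [hdetZ] at hdet0 ⊢
      exact_mod_cast Int.one_le_abs (by exact_mod_cast hdet0)
    have h2 : |A.det| ≤ (N + 1)! * (H * ((N + 1) * H * (2 * ρ)) ^ N) := by
      refine abs_det_le_of_wedgeNorm_le (fun i => intVec (w i)) (by positivity)
        (fun i j => (hzH _ j).trans (hpH _)) (hz0 _) fun i => ?_
      have h0 : ∀ i, 0 < ‖intVec (w i)‖ := fun i => norm_pos_iff.2 (hz0 _)
      rw [← div_le_iff₀ (mul_pos (h0 0) (h0 i)), ← projDist_mk _ _ (hz0 _) (hz0 _), ← hz, ← hz]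
      have h3 := dist_triangle_right (ratPoint (p (Fin.cast hcard.symm 0)))
        (ratPoint (p (Fin.cast hcard.symm i))) y
      have h4 := hpy (Fin.cast hcard.symm 0)
      have h5 := hpy (Fin.cast hcard.symm i)
      exact h3.trans (by linarith)
    linarith
  obtain ⟨L, hL, hSL⟩ := exists_finrank_eq_of_lt_top hspan
  refine ⟨pointsOn L, ⟨L, hL, rfl⟩, fun q hqH hqy => ?_⟩
  change (ratPoint q).submodule ≤ L
  rw [hz q, Projectivization.submodule_mk, Submodule.span_singleton_le_iff_mem]
  exact hSL (Submodule.subset_span ⟨q, hqH, hqy, rfl⟩)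

/-- The simplex lemma at scale `r`: the rational points `q` close to `y` for which
`H(q) ^ ((N + 1) / N)` is less than `κ / r` lie on one hyperplane. -/
lemma exists_isProjHyperplane_scale {N : ℕ} (hN : 1 ≤ N) :
    ∃ κ : ℝ, 0 < κ ∧ ∀ r : ℝ, 0 < r → ∀ y : RealProj N, ∃ P : Set (RealProj N),
      IsProjHyperplane P ∧ ∀ q : RatProj N, q.mulHeight ^ (((N : ℝ) + 1) / N) * r < κ →
        dist (ratPoint q) y ≤ 2 * r → ratPoint q ∈ P := by
  have hN0 : (0 : ℝ) < N := by exact_mod_cast hN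
  set C : ℝ := (N + 1)! * ((N + 1) * 4) ^ N with hC
  have hC0 : 0 < C := by positivity
  refine ⟨1 / (C + 1), by positivity, fun r hr y => ?_⟩
  set κ := 1 / (C + 1) with hκ
  have hκ0 : 0 < κ := by positivity
  have hκ1 : κ ≤ 1 := by rw [hκ, div_le_one (by positivity)]; linarith
  have hCκ : C * κ ^ N < 1 := by
    have h1 : κ ^ N ≤ κ := by simpa using pow_le_pow_of_le_one hκ0.le hκ1 hN
    have h2 : C * κ < 1 := by rw [hκ, mul_one_div, div_lt_one (by positivity)]; linarith
    nlinarith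
  set H : ℝ := (κ / r) ^ ((N : ℝ) / (N + 1)) with hH
  have hHpow : H ^ (N + 1) = (κ / r) ^ N := by
    rw [hH, ← Real.rpow_natCast, ← Real.rpow_mul (by positivity), ← Real.rpow_natCast]
    congr 1
    push_cast
    field_simp
  have hsmall : ((N + 1)! : ℝ) * (H * ((N + 1) * H * (2 * (2 * r))) ^ N) = C * κ ^ N := by
    calc ((N + 1)! : ℝ) * (H * ((N + 1) * H * (2 * (2 * r))) ^ N)
        = C * (H ^ (N + 1) * r ^ N) := by
          rw [hC, show ((N : ℝ) + 1) * H * (2 * (2 * r)) = ((N + 1) * 4) * H * r by ring,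
            mul_pow, mul_pow (((N : ℝ) + 1) * 4) H, pow_succ]
          ring
      _ = C * κ ^ N := by
          rw [hHpow, ← mul_pow, div_mul_cancel₀ _ hr.ne']
  obtain ⟨P, hP, hPq⟩ := exists_isProjHyperplane_of_mulHeight_le (N := N) (H := H) (ρ := 2 * r)
    (by positivity) (hsmall.trans_lt hCκ) y
  refine ⟨P, hP, fun q hq hqy => hPq q ?_ hqy⟩
  rw [← lt_div_iff₀ hr] at hq
  have h0 : 0 ≤ q.mulHeight := q.mulHeight_pos.le
  have := Real.rpow_le_rpow (Real.rpow_nonneg h0 _) hq.le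
    (show 0 ≤ (N : ℝ) / (N + 1) by positivity)
  rwa [← Real.rpow_mul h0, div_mul_div_cancel₀ hN0.ne', div_self (by positivity),
    Real.rpow_one] at this

/-! ### Badly approximable points -/

/-- To be badly approximable, it suffices to stay at distance `ρ * β ^ (n + 1)`, for every `n`, from
the rational points relevant at scale `ρ * β ^ n`: each rational point becomes relevant at some
scale, and the first such scale is comparable with `H(q) ^ (-(N + 1) / N)`, or it is the scale `ρ`
with `n = 0`, where `H(q) ≥ 1` suffices. -/
lemma mem_Bad_of_avoiding {N : ℕ} (hN : 1 ≤ N) {κ β ρ : ℝ} (hκ : 0 < κ) (hβ : 0 < β) (hβ1 : β < 1)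
    (hρ : 0 < ρ) {x : RealProj N}
    (h : ∀ n : ℕ, ∀ q : RatProj N, q.mulHeight ^ (((N : ℝ) + 1) / N) * (ρ * β ^ n) < κ →
      ρ * β ^ (n + 1) ≤ dist x (ratPoint q)) : x ∈ Bad N := by
  have hN0 : (0 : ℝ) < N := by exact_mod_cast hN
  refine lt_of_lt_of_le (show 0 < min (β * ρ) (β ^ 2 * κ) by positivity) (le_ciInf fun q => ?_)
  set h' := q.mulHeight ^ (((N : ℝ) + 1) / N) with hh'
  have h1 : 1 ≤ h' := Real.one_le_rpow q.one_le_mulHeight (by positivity)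
  have hex : ∃ n : ℕ, h' * (ρ * β ^ n) < κ := by
    have ht : Tendsto (fun n : ℕ => h' * (ρ * β ^ n)) atTop (𝓝 0) := by
      simpa using ((tendsto_pow_atTop_nhds_zero_of_lt_one hβ.le hβ1).const_mul ρ).const_mul h'
    exact (ht.eventually_lt_const hκ).exists
  classical
  obtain ⟨n, hn, hmin⟩ : ∃ n, h' * (ρ * β ^ n) < κ ∧ ∀ k < n, ¬ h' * (ρ * β ^ k) < κ :=
    ⟨Nat.find hex, Nat.find_spec hex, fun k hk => Nat.find_min hex hk⟩
  have hd := h n q hn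
  cases n with
  | zero =>
    refine (min_le_left _ _).trans ?_
    calc β * ρ = 1 * (ρ * β ^ (0 + 1)) := by ring
      _ ≤ h' * dist x (ratPoint q) := by gcongr
  | succ k =>
    have hk := not_lt.1 (hmin k (by omega))
    refine (min_le_right _ _).trans ?_
    calc β ^ 2 * κ ≤ β ^ 2 * (h' * (ρ * β ^ k)) := by gcongr
      _ = h' * (ρ * β ^ (k + 1 + 1)) := by ring
      _ ≤ h' * dist x (ratPoint q) := by gcongr

/-- The lower bound, obtained by taking as obstacle of each ball the hyperplane that contains the
rational points relevant at its scale. -/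
theorem ofReal_le_dimH_Bad_inter {N : ℕ} (hN : 1 ≤ N) {Ω : Set (RealProj N)} (hΩ : IsCompact Ω)
    (hne : Ω.Nonempty) {δ η : ℝ} (hδ : 0 < δ) (hη : 0 < η) (m : Measure (RealProj N))
    [IsFiniteMeasure m] (hsupp : m Ωᶜ = 0) (hreg : IsAhlforsRegular Ω δ m)
    (hdec : IsProjAbsDecaying Ω η m) : ENNReal.ofReal δ ≤ dimH (Bad N ∩ Ω) := by
  obtain ⟨a, b, r₁, ha, -, hb, hr₁, hreg⟩ := hreg
  obtain ⟨c, r₂, -, hr₂, hdec⟩ := hdec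
  refine le_of_forall_lt_imp_le_of_dense fun t ht => ?_
  have htop : t ≠ ⊤ := ne_top_of_lt ht
  set s := max t.toReal (δ / 2) with hs
  have hs0 : 0 < s := lt_max_of_lt_right (half_pos hδ)
  have hsδ : s < δ := max_lt ((ENNReal.lt_ofReal_iff_toReal_lt htop).1 ht) (half_lt_self hδ)
  have hts : t ≤ ENNReal.ofReal s :=
    (ENNReal.ofReal_toReal htop).symm.le.trans (ENNReal.ofReal_le_ofReal (le_max_left _ _))
  obtain ⟨β, ρ, hβ, hβ1, hρ, hav⟩ := le_dimH_avoiding hΩ hne m hsupp ha (by linarith) hs0 hsδ hη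
    (lt_min hr₁ hr₂) (fun x hx r h0 h1 => hreg x hx r h0 (h1.trans_le (min_le_left _ _)))
    (𝓗 := {P | IsProjHyperplane P})
    (fun P hP ε hε x hx r h0 h1 => hdec P hP ε hε x hx r h0 (h1.trans_le (min_le_right _ _)))
  obtain ⟨κ, hκ, hplane⟩ := exists_isProjHyperplane_scale hN
  have hpos : ∀ n : ℕ, 0 < ρ * β ^ n := fun n => by positivity
  choose P hP hPq using fun n : ℕ => hplane (ρ * β ^ n) (hpos n)
  refine hts.trans ((hav P hP).trans (dimH_mono ?_))
  rintro x ⟨hxΩ, hx⟩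
  refine ⟨mem_Bad_of_avoiding hN hκ hβ hβ1 hρ fun n q hq => ?_, hxΩ⟩
  obtain ⟨y, hxy, hxP⟩ := hx n
  by_contra! hlt
  refine hxP (mem_thickening_iff.2 ⟨ratPoint q, hPq n y q hq ?_, hlt⟩)
  have h1 := dist_triangle_left (ratPoint q) y x
  have h2 : ρ * β ^ (n + 1) ≤ ρ * β ^ n := by
    rw [pow_succ, ← mul_assoc]
    exact mul_le_of_le_one_right (hpos n).le hβ1.le
  linarith

end ProjBad

theorem mainTheorem1 (N : ℕ) (hN : 1 ≤ N) (Ω : Set (ProjBad.RealProj N)) (hΩ : IsCompact Ω)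
    (hne : Ω.Nonempty) (δ η : ℝ) (hδ : 0 < δ) (hη : 0 < η)
    (m : MeasureTheory.Measure (ProjBad.RealProj N)) [MeasureTheory.IsLocallyFiniteMeasure m]
    (hsupp : m Ωᶜ = 0)
    (hreg : ProjBad.IsAhlforsRegular Ω δ m) (hdec : ProjBad.IsProjAbsDecaying Ω η m) :
    dimH (ProjBad.Bad N ∩ Ω) = dimH Ω ∧ dimH Ω = ENNReal.ofReal δ := by
  have hfin : MeasureTheory.IsFiniteMeasure m := by
    constructor
    rw [← Set.union_compl_self Ω]
    refine (MeasureTheory.measure_union_le _ _).trans_lt ?_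
    rw [hsupp, add_zero]
    exact hΩ.measure_lt_top
  have hlower := ProjBad.ofReal_le_dimH_Bad_inter hN hΩ hne hδ hη m hsupp hreg hdec
  have hmono : dimH (ProjBad.Bad N ∩ Ω) ≤ dimH Ω := dimH_mono Set.inter_subset_right
  obtain ⟨a, b, r₁, ha, -, -, hr₁, hreg⟩ := hreg
  have hupper : dimH Ω ≤ ENNReal.ofReal δ :=
    ProjBad.dimH_le_of_le_measure_closedBall hΩ m ha hδ.le hr₁
      fun x hx r h0 h1 => (hreg x hx r h0 h1).1
  exact ⟨le_antisymm hmono (hupper.trans hlower), le_antisymm hupper (hlower.trans hmono)⟩
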